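/- Let $d\ge 1$ be an integer and let $S(\mathbb{R}^d)$ be the set of (classes modulo a.e. equality of) Lebesgue measurable functions $f:\mathbb{R}^d\to\mathbb{C}$ such that $\{|f|>n\}$ has finite Lebesgue measure $m$ for some $n\in\mathbb{N}$. For $f\in S(\mathbb{R}^d)$ let $$\mu(t,f)=\inf\{s\ge 0:\ m(\{|f|>s\})\le t\},\quad t>0,$$ be its decreasing rearrangement. A symmetric Banach function space $E=E(\mathbb{R}^d)$ is a linear subspace of $S(\mathbb{R}^d)$ with a complete norm $\|\cdot\|_E$ such that, for $f\in E$ and $g\in S(\mathbb{R}^d)$: (1) if $|g|\le|f|$ a.e., then $g\in E$ and $\|g\|_E\le\|f\|_E$; (2) if $\mu(g)=\mu(f)$, then $g\in E$ and $\|g\|_E=\|f\|_E$. Let $$\psi(t)=\frac{1}{\log(e/t)}\ \ (0<t<1),\qquad \psi(t)=t\ \ (t\ge 1),$$ let $\Lambda_\psi(\mathbb{R}^d)=\{f\in S(\mathbb{R}^d):\ \int_0^\infty\mu(s,f)\,d\psi(s)<\infty\}$ (Lebesgue–Stieltjes integral) and let $\Lambda_\psi^{(2)}(\mathbb{R}^d)=\{f\in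 S(\mathbb{R}^d):\ |f|^2\in\Lambda_\psi(\mathbb{R}^d)\}$ be its $2$-convexification. Let $(1-\Delta)^{-d/4}$ be the bounded operator on $L_2(\mathbb{R}^d)$ that multiplies the Fourier transform $\int x(t)e^{-2\pi i\langle t,\xi\rangle}\,dt$ of $x$ by $(1+4\pi^2|\xi|^2)^{-d/4}$. If $E(\mathbb{R}^d)$ is a symmetric Banach function space on $\mathbb{R}^d$ and $(1-\Delta)^{-d/4}$ maps $L_2(\mathbb{R}^d)$ into $E(\mathbb{R}^d)$, that is, $(1-\Delta)^{-d/4}x\in E(\mathbb{R}^d)$ for all $x\in L_2(\mathbb{R}^d)$, then $$\Lambda_\psi^{(2)}(\mathbb{R}^d)\subset (E+L_\infty)(\mathbb{R}^d),$$ that is, every $f\in\Lambda_\psi^{(2)}(\mathbb{R}^d)$ can be written as $f=g+h$ with $g\in E(\mathbb{R}^d)$ and $h\in L_\infty(\mathbb{R}^d)$. -/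

import Mathlib

open MeasureTheory Filter Topology Set
open scoped ENNReal NNReal FourierTransform Pointwise

namespace SymmetricSpaces

section Rearrangement

variable {Ω : Type*} [MeasurableSpace Ω]

/-- `S(Ω, ν)`: the (classes modulo a.e. equality of) `ν`-measurable functions `f` such that, for some
`n`, the function `|f| χ_{|f| > n}` is supported on a set of finite measure. -/
def S (ν : Measure Ω) : Set (Ω →ₘ[ν] ℂ) :=
  {f | ∃ n : ℕ, ν {x | (n : ℝ) < ‖f x‖} < ∞}

/-- The decreasing rearrangement
`μ(t, f) = inf {s ≥ 0 : ν {|f| > s} ≤ t}`, for `t > 0`. -/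
noncomputable def rearr (ν : Measure Ω) (f : Ω →ₘ[ν] ℂ) (t : ℝ) : ℝ≥0∞ :=
  sInf {s : ℝ≥0∞ | ν {x | s < ‖f x‖ₑ} ≤ ENNReal.ofReal t}

/-- A symmetric Banach function space `E ⊆ S(Ω, ν)`: a linear subspace with a complete norm which is
monotone with respect to `|·|` and invariant under passing to a function with the same decreasing
rearrangement. -/
structure SymmetricBanachFunctionSpace (ν : Measure Ω) where
  /-- the underlying linear space of functions -/
  toSubmodule : Submodule ℂ (Ω →ₘ[ν] ℂ)
  subset_S : (toSubmodule : Set (Ω →ₘ[ν] ℂ)) ⊆ S ν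
  /-- the norm (the field `eq_zero_of_norm` makes this seminorm a norm) -/
  norm : Seminorm ℂ toSubmodule
  eq_zero_of_norm : ∀ f : toSubmodule, norm f = 0 → f = 0
  complete : ∀ u : ℕ → toSubmodule,
    (∀ ε : ℝ, 0 < ε → ∃ N, ∀ m, N ≤ m → ∀ n, N ≤ n → norm (u m - u n) < ε) →
      ∃ f : toSubmodule, Tendsto (fun n => norm (u n - f)) atTop (𝓝 0)
  solid : ∀ f : toSubmodule, ∀ g ∈ S ν, (∀ᵐ x ∂ν, ‖g x‖ ≤ ‖(f : Ω →ₘ[ν] ℂ) x‖) →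
    ∃ hg : g ∈ toSubmodule, norm ⟨g, hg⟩ ≤ norm f
  symmetric : ∀ f : toSubmodule, ∀ g ∈ S ν, (∀ t : ℝ, 0 < t → rearr ν g t = rearr ν f t) →
    ∃ hg : g ∈ toSubmodule, norm ⟨g, hg⟩ = norm f

/-- The Lorentz space `Λ_ψ(Ω, ν) = {f ∈ S(Ω, ν) : ∫_0^∞ μ(s, f) dψ(s) < ∞}`; the integral is the
Lebesgue–Stieltjes integral over `(0, ∞)`. -/
def lorentzSpace (ψ : StieltjesFunction ℝ) (ν : Measure Ω) : Set (Ω →ₘ[ν] ℂ) :=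
  {f | f ∈ S ν ∧ ∫⁻ s in Ioi (0 : ℝ), rearr ν f s ∂ψ.measure < ∞}

/-- The class of `|f|²`. -/
noncomputable def absSq {ν : Measure Ω} (f : Ω →ₘ[ν] ℂ) : Ω →ₘ[ν] ℂ :=
  AEEqFun.comp (fun z : ℂ => ((‖z‖ ^ 2 : ℝ) : ℂ)) (by fun_prop) f

/-- The `2`-convexification `E^{(2)} = {f ∈ S(Ω, ν) : |f|² ∈ E}`. -/
def twoConvexification {ν : Measure Ω} (E : Set (Ω →ₘ[ν] ℂ)) : Set (Ω →ₘ[ν] ℂ) :=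
  {f | f ∈ S ν ∧ absSq f ∈ E}

end Rearrangement

section Psi

/-- `ψ(t) = 1 / log (e / t)` for `0 < t < 1` and `ψ(t) = t` for `t ≥ 1`, extended by `0` to
`t ≤ 0`. -/
noncomputable def psiFun (t : ℝ) : ℝ :=
  if t ≤ 0 then 0 else if t < 1 then 1 / Real.log (Real.exp 1 / t) else t

theorem psiFun_of_mem {t : ℝ} (h0 : 0 < t) (h1 : t < 1) :
    psiFun t = 1 / (1 - Real.log t) := by
  rw [psiFun, if_neg h0.not_ge, if_pos h1, Real.log_div (Real.exp_pos 1).ne' h0.ne', Real.log_exp]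

theorem psiFun_of_one_le {t : ℝ} (h1 : 1 ≤ t) : psiFun t = t := by
  rw [psiFun, if_neg (by linarith), if_neg (by linarith)]

theorem psiFun_of_nonpos {t : ℝ} (h : t ≤ 0) : psiFun t = 0 := by
  rw [psiFun, if_pos h]

theorem psiFun_mono : Monotone psiFun := by
  intro a b hab
  rcases le_or_gt a 0 with ha | ha
  · rw [psiFun_of_nonpos ha]
    rcases le_or_gt b 0 with hb | hb
    · rw [psiFun_of_nonpos hb]
    rcases lt_or_ge b 1 with hb1 | hb1
    · rw [psiFun_of_mem hb hb1]
      have := Real.log_neg hb hb1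
      exact div_nonneg zero_le_one (by linarith)
    · rw [psiFun_of_one_le hb1]; linarith
  have hb : 0 < b := ha.trans_le hab
  rcases lt_or_ge b 1 with hb1 | hb1
  · rw [psiFun_of_mem ha (hab.trans_lt hb1), psiFun_of_mem hb hb1]
    have h1 := Real.log_neg hb hb1
    have h2 := Real.log_le_log ha hab
    exact one_div_le_one_div_of_le (by linarith) (by linarith)
  rw [psiFun_of_one_le hb1]
  rcases lt_or_ge a 1 with ha1 | ha1
  · rw [psiFun_of_mem ha ha1]
    have h1 := Real.log_neg ha ha1
    refine le_trans ?_ hb1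
    rw [div_le_one (by linarith)]
    linarith
  · rwa [psiFun_of_one_le ha1]

theorem psiFun_right_continuous (x : ℝ) : ContinuousWithinAt psiFun (Ici x) x := by
  rcases lt_trichotomy x 0 with hx | rfl | hx
  · have : psiFun =ᶠ[𝓝 x] fun _ => 0 := by
      filter_upwards [Iio_mem_nhds hx] with t ht using psiFun_of_nonpos (le_of_lt ht)
    exact (continuousAt_const.congr this.symm).continuousWithinAt
  · rw [← continuousWithinAt_Ioi_iff_Ici]
    unfold ContinuousWithinAt
    rw [psiFun_of_nonpos le_rfl]
    have h : Tendsto (fun t : ℝ => (1 - Real.log t)⁻¹) (𝓝[>] 0) (𝓝 0) := by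
      apply Tendsto.inv_tendsto_atTop
      have := tendsto_neg_atBot_atTop.comp Real.tendsto_log_nhdsGT_zero
      simpa [sub_eq_add_neg] using tendsto_atTop_add_const_left (𝓝[>] (0 : ℝ)) (1 : ℝ) this
    refine h.congr' ?_
    filter_upwards [Ioo_mem_nhdsGT (zero_lt_one' ℝ)] with t ht
    rw [psiFun_of_mem ht.1 ht.2, one_div]
  · rcases lt_or_ge x 1 with hx1 | hx1
    · have : psiFun =ᶠ[𝓝 x] fun t => 1 / (1 - Real.log t) := by
        filter_upwards [Ioo_mem_nhds hx hx1] with t ht using psiFun_of_mem ht.1 ht.2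
      have hl := Real.log_neg hx hx1
      refine (ContinuousAt.congr ?_ this.symm).continuousWithinAt
      exact continuousAt_const.div (continuousAt_const.sub (Real.continuousAt_log hx.ne'))
        (by linarith)
    · refine continuousWithinAt_id.congr (fun t ht => ?_) (psiFun_of_one_le hx1)
      exact psiFun_of_one_le (hx1.trans ht)

/-- The function `ψ` as a monotone right-continuous function, so that `dψ = psi.measure`. -/
noncomputable def psi : StieltjesFunction ℝ where
  toFun := psiFun
  mono' := psiFun_mono
  right_continuous' := psiFun_right_continuous

end Psi

section Bessel

variable {d : ℕ}

/-- The symbol `(1 + |2πξ|²)^{-α}` of `(1 - Δ)^{-α}`, in the normalisation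
`𝓕 x (ξ) = ∫ x(t) exp (-2πi⟨t, ξ⟩) dt` of the Fourier transform. -/
noncomputable def besselSymbol (α : ℝ≥0) (ξ : EuclideanSpace ℝ (Fin d)) : ℂ :=
  (((1 + (2 * Real.pi * ‖ξ‖) ^ 2) ^ (-(α : ℝ)) : ℝ) : ℂ)

theorem memLp_besselSymbol (α : ℝ≥0) :
    MemLp (besselSymbol α) ∞ (volume : Measure (EuclideanSpace ℝ (Fin d))) := by
  refine memLp_top_of_bound (C := 1) ?_ (Eventually.of_forall fun ξ => ?_)
  · have : Continuous (besselSymbol α : EuclideanSpace ℝ (Fin d) → ℂ) := by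
      unfold besselSymbol
      refine Complex.continuous_ofReal.comp (Continuous.rpow_const (by fun_prop) fun ξ => ?_)
      exact Or.inl (by positivity)
    exact this.aestronglyMeasurable
  · rw [besselSymbol, Complex.norm_real, Real.norm_of_nonneg (by positivity)]
    exact Real.rpow_le_one_of_one_le_of_nonpos (by nlinarith [sq_nonneg (2 * Real.pi * ‖ξ‖)])
      (by simp)

/-- The operator `(1 - Δ)^{-α}`, `α ≥ 0`, on `L_2(ℝ^d)`: the Fourier multiplier
`x ↦ 𝓕⁻¹ ((1 + |2πξ|²)^{-α} 𝓕 x)`. -/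
noncomputable def oneSubLaplacianNegPow (α : ℝ≥0)
    (x : Lp ℂ 2 (volume : Measure (EuclideanSpace ℝ (Fin d)))) :
    Lp ℂ 2 (volume : Measure (EuclideanSpace ℝ (Fin d))) :=
  𝓕⁻ (((memLp_besselSymbol α).toLp (besselSymbol α) :
      Lp ℂ ∞ (volume : Measure (EuclideanSpace ℝ (Fin d)))) •
    (𝓕 x : Lp ℂ 2 (volume : Measure (EuclideanSpace ℝ (Fin d)))) :
      Lp ℂ 2 (volume : Measure (EuclideanSpace ℝ (Fin d))))

end Bessel

end SymmetricSpaces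

/-! ### Almost orthogonal series in a Hilbert space -/

section AlmostOrthogonal

/-! Cut `f` at a height `N` so large that the part `F` above it lives on a set no bigger than the
unit ball; the rest is bounded by `N`. Since `E` is symmetric and solid, `F ∈ E` follows once the
radial decreasing rearrangement of `F` is dominated by a multiple of some `|(1 - Δ)^{-d/4} x|` with
`x ∈ L²`.

Such an `x` is built from dyadic Gaussians. Let `v_k` be the Fourier transform of `exp (-π 4^k
|t|²)` divided by the Bessel symbol. The `v_k` are almost orthogonal in `L²`, with inner products
`O(2^{-|j-k|})`, so `∑ b_k v_k` converges for every square-summable `b`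
(`summable_smul_of_almost_orthogonal`), and `(1 - Δ)^{-d/4}` sends its inverse Fourier transform to
`∑ b_k exp (-π 4^k |t|²)` (`exists_oneSubLaplacianNegPow_ge`).

Take `b_k = f*(r_k) / (k + 1)`, where `r_k` decays like `4^{-dk}`. The `dψ`-mass of `(r_{k+1}, r_k]`
is at least of order `(k + 1)^{-2}`, so the Lorentz condition on `|f|²` makes `b` square-summable
(`summable_rearr_sq`). For `|t|` near `2^{-n}`, the roughly `n/2` indices `k` in `[n/2, n]` each
contribute at least a constant times `F*(v|t|^d) / (n + 1)`, with `v` the volume of the unit ball;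
together they recover `F*(v|t|^d)` up to a constant (`le_sum_gaussian`). -/

theorem sum_range_half_pow_dist_le (j N : ℕ) :
    ∑ k ∈ Finset.range N, (1 / 2 : ℝ) ^ ((j - k) + (k - j)) ≤ 4 := by
  -- With truncated subtraction, `(j - k) + (k - j)` is `|j - k|`. The two terms on the right bound
  -- the geometric sums over `k ≤ j` and `k > j`, in a form that survives induction on `N`.
  have key : ∑ k ∈ Finset.range N, (1 / 2 : ℝ) ^ ((j - k) + (k - j)) ≤
      2 * (1 / 2 : ℝ) ^ (j + 1 - N) + 2 * (1 - (1 / 2 : ℝ) ^ (N - (j + 1))) := by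
    induction N with
    | zero => simp
    | succ N ih =>
      rw [Finset.sum_range_succ]
      rcases le_or_gt N j with h | h
      · have h1 : j + 1 - N = (j - N) + 1 := by omega
        have h2 : N - (j + 1) = 0 := by omega
        have h3 : j + 1 - (N + 1) = j - N := by omega
        have h4 : N + 1 - (j + 1) = 0 := by omega
        have h5 : N - j = 0 := by omega
        rw [h1, h2] at ih
        rw [h3, h4, h5, add_zero]
        rw [pow_succ] at ih
        linarith
      · obtain ⟨m, rfl⟩ : ∃ m, N = j + 1 + m := ⟨N - (j + 1), by omega⟩
        have h1 : j + 1 - (j + 1 + m) = 0 := by omega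
        have h2 : j + 1 + m - (j + 1) = m := by omega
        have h3 : j + 1 - (j + 1 + m + 1) = 0 := by omega
        have h4 : j + 1 + m + 1 - (j + 1) = m + 1 := by omega
        have h5 : j - (j + 1 + m) + (j + 1 + m - j) = m + 1 := by omega
        rw [h1, h2] at ih
        rw [h3, h4, h5]
        rw [pow_succ]
        have : (0 : ℝ) ≤ (1 / 2 : ℝ) ^ m := by positivity
        linarith
  have h1 : (1 / 2 : ℝ) ^ (j + 1 - N) ≤ 1 := pow_le_one₀ (by norm_num) (by norm_num)
  have h2 : (0 : ℝ) ≤ (1 / 2 : ℝ) ^ (N - (j + 1)) := by positivity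
  linarith

theorem sum_half_pow_dist_le (j : ℕ) (s : Finset ℕ) :
    ∑ k ∈ s, (1 / 2 : ℝ) ^ ((j - k) + (k - j)) ≤ 4 := by
  obtain ⟨N, hN⟩ := s.exists_nat_subset_range
  exact (Finset.sum_le_sum_of_subset_of_nonneg hN fun _ _ _ => by positivity).trans
    (sum_range_half_pow_dist_le j N)

variable {H : Type*} [NormedAddCommGroup H] [InnerProductSpace ℂ H]

/-- Schur's test: expand the square, use `|b_j b_k| ≤ (b_j² + b_k²) / 2`, and sum the kernel
`2^{-|j-k|}` along rows, each of total at most `4`. -/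
theorem norm_sum_smul_sq_le_of_almost_orthogonal {v : ℕ → H} {C : ℝ}
    (hv : ∀ j k, ‖inner ℂ (v j) (v k)‖ ≤ C * (1 / 2 : ℝ) ^ ((j - k) + (k - j)))
    (b : ℕ → ℝ) (s : Finset ℕ) :
    ‖∑ k ∈ s, (b k : ℂ) • v k‖ ^ 2 ≤ 4 * C * ∑ k ∈ s, b k ^ 2 := by
  have hC : 0 ≤ C := by
    have := (norm_nonneg _).trans (hv 0 0)
    simpa using this
  have hterm : ∀ j k, ‖inner ℂ ((b j : ℂ) • v j) ((b k : ℂ) • v k)‖ ≤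
      C / 2 * (b j ^ 2 * (1 / 2 : ℝ) ^ ((j - k) + (k - j))) +
        C / 2 * (b k ^ 2 * (1 / 2 : ℝ) ^ ((k - j) + (j - k))) := by
    intro j k
    rw [inner_smul_left, inner_smul_right, norm_mul, norm_mul, RCLike.norm_conj,
      Complex.norm_real, Complex.norm_real, Real.norm_eq_abs, Real.norm_eq_abs,
      add_comm (k - j) (j - k)]
    calc |b j| * (|b k| * ‖inner ℂ (v j) (v k)‖)
        = (|b j| * |b k|) * ‖inner ℂ (v j) (v k)‖ := by ring
      _ ≤ ((b j ^ 2 + b k ^ 2) / 2) * (C * (1 / 2 : ℝ) ^ ((j - k) + (k - j))) := by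
          apply mul_le_mul _ (hv j k) (norm_nonneg _) (by positivity)
          nlinarith [sq_nonneg (|b j| - |b k|), sq_abs (b j), sq_abs (b k)]
      _ = _ := by ring
  have h1 : ‖∑ k ∈ s, (b k : ℂ) • v k‖ ^ 2 ≤
      ∑ j ∈ s, ∑ k ∈ s, ‖inner ℂ ((b j : ℂ) • v j) ((b k : ℂ) • v k)‖ := by
    have h0 : ∀ z : H, ‖z‖ ^ 2 = ‖inner ℂ z z‖ := fun z => by
      rw [inner_self_eq_norm_sq_to_K]; simp
    rw [h0, sum_inner]
    refine (norm_sum_le _ _).trans (Finset.sum_le_sum fun j _ => ?_)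
    rw [inner_sum]
    exact norm_sum_le _ _
  refine h1.trans ?_
  calc ∑ j ∈ s, ∑ k ∈ s, ‖inner ℂ ((b j : ℂ) • v j) ((b k : ℂ) • v k)‖
      ≤ ∑ j ∈ s, ∑ k ∈ s, (C / 2 * (b j ^ 2 * (1 / 2 : ℝ) ^ ((j - k) + (k - j))) +
        C / 2 * (b k ^ 2 * (1 / 2 : ℝ) ^ ((k - j) + (j - k)))) :=
        Finset.sum_le_sum fun j _ => Finset.sum_le_sum fun k _ => hterm j k
    _ = C * ∑ j ∈ s, b j ^ 2 * ∑ k ∈ s, (1 / 2 : ℝ) ^ ((j - k) + (k - j)) := by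
        simp only [Finset.sum_add_distrib, ← Finset.mul_sum]
        rw [Finset.sum_comm (f := fun j k => b k ^ 2 * (1 / 2 : ℝ) ^ ((k - j) + (j - k)))]
        simp only [← Finset.mul_sum]
        ring
    _ ≤ C * ∑ j ∈ s, b j ^ 2 * 4 := by
        gcongr with j _
        exact sum_half_pow_dist_le j s
    _ = _ := by rw [← Finset.sum_mul]; ring

theorem summable_smul_of_almost_orthogonal [CompleteSpace H] {v : ℕ → H} {C : ℝ}
    (hv : ∀ j k, ‖inner ℂ (v j) (v k)‖ ≤ C * (1 / 2 : ℝ) ^ ((j - k) + (k - j)))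
    {b : ℕ → ℝ} (hb : Summable fun k => b k ^ 2) : Summable fun k => (b k : ℂ) • v k := by
  have hC : 0 ≤ C := by
    have := (norm_nonneg _).trans (hv 0 0)
    simpa using this
  rw [summable_iff_vanishing_norm] at hb ⊢
  intro ε hε
  obtain ⟨s, hs⟩ := hb (ε ^ 2 / (4 * C + 1)) (by positivity)
  refine ⟨s, fun t ht => ?_⟩
  have h1 := hs t ht
  rw [Real.norm_of_nonneg (Finset.sum_nonneg fun _ _ => sq_nonneg _),
    lt_div_iff₀ (by positivity)] at h1
  have h2 := norm_sum_smul_sq_le_of_almost_orthogonal hv b t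
  have h3 : (0 : ℝ) ≤ ∑ k ∈ t, b k ^ 2 := Finset.sum_nonneg fun _ _ => sq_nonneg _
  refine lt_of_pow_lt_pow_left₀ 2 hε.le ?_
  linarith

end AlmostOrthogonal

/-! ### The Fourier transform on `L¹ ∩ L²` -/

section FourierL2

variable {V : Type*} [NormedAddCommGroup V] [InnerProductSpace ℝ V] [FiniteDimensional ℝ V]
  [MeasurableSpace V] [BorelSpace V]

/-- On `L¹ ∩ L²` the Fourier transform of `L²` is given by the Fourier integral. -/
theorem fourier_toLp_eq_of_integrable {f : V → ℂ} (hf : Integrable f) (hf2 : MemLp f 2)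
    (hF2 : MemLp (𝓕 f) 2) : 𝓕 (hf2.toLp f : Lp ℂ 2 (volume : Measure V)) = hF2.toLp (𝓕 f) := by
  -- `L²` embeds in the tempered distributions, so it suffices to test against Schwartz functions,
  -- where the claim is `∫ φ̂ f = ∫ φ f̂`.
  have hker := Lp.ker_toTemperedDistributionCLM_eq_bot (F := ℂ) (μ := (volume : Measure V)) (p := 2)
  have hinj := LinearMap.ker_eq_bot.1 hker
  apply hinj
  change Lp.toTemperedDistribution _ = Lp.toTemperedDistribution _
  rw [← Lp.fourier_toTemperedDistribution_eq]
  ext φ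
  rw [TemperedDistribution.fourier_apply, Lp.toTemperedDistribution_apply,
    Lp.toTemperedDistribution_apply]
  have e1 : ∫ x, (𝓕 φ) x • (hf2.toLp f) x = ∫ x, (𝓕 (φ : V → ℂ)) x • f x := by
    apply integral_congr_ae
    filter_upwards [hf2.coeFn_toLp] with x hx
    rw [hx, SchwartzMap.fourier_coe]
  have e2 : ∫ x, φ x • (hF2.toLp (𝓕 f)) x = ∫ x, φ x • (𝓕 f) x := by
    apply integral_congr_ae
    filter_upwards [hF2.coeFn_toLp] with x hx
    rw [hx]
  rw [e1, e2]
  have := VectorFourier.integral_fourierIntegral_smul_eq_flip (L := innerₗ V)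
    (μ := (volume : Measure V)) (ν := (volume : Measure V)) (f := φ) (g := f)
    Real.continuous_fourierChar continuous_inner φ.integrable hf
  rwa [flip_innerₗ] at this

end FourierL2

/-! ### Dyadic Gaussians in the range of the Bessel potential -/

section Gaussians

variable {d : ℕ}

theorem integrable_exp_neg_mul_norm_sq {b : ℝ} (hb : 0 < b) :
    Integrable fun v : EuclideanSpace ℝ (Fin d) => Real.exp (-b * ‖v‖ ^ 2) := by
  have h := (GaussianFourier.integrable_cexp_neg_mul_sq_norm_add
    (V := EuclideanSpace ℝ (Fin d)) (b := (b : ℂ)) (by simpa using hb) 0 0).re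
  refine h.congr (Eventually.of_forall fun v => ?_)
  have : (-(b : ℂ) * (‖v‖ : ℂ) ^ 2 + 0 * ((inner ℝ (0 : EuclideanSpace ℝ (Fin d)) v : ℝ) : ℂ)) =
      ((-b * ‖v‖ ^ 2 : ℝ) : ℂ) := by push_cast; ring
  simp only [this, ← Complex.ofReal_exp]
  rfl

/-- The Gaussian `t ↦ exp (-π |t|² / p²)`. -/
noncomputable def gauss (p : ℝ) (t : EuclideanSpace ℝ (Fin d)) : ℂ :=
  ((Real.exp (-(Real.pi / p ^ 2) * ‖t‖ ^ 2) : ℝ) : ℂ)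

/-- The Fourier transform of `gauss p`. -/
noncomputable def gaussHat (p : ℝ) (ξ : EuclideanSpace ℝ (Fin d)) : ℂ :=
  ((p ^ d * Real.exp (-(Real.pi * p ^ 2) * ‖ξ‖ ^ 2) : ℝ) : ℂ)

/-- The function whose product with the symbol of `(1 - Δ)^{-d/4}` is `gaussHat p`. -/
noncomputable def besselGaussHat (p : ℝ) (ξ : EuclideanSpace ℝ (Fin d)) : ℝ :=
  (1 + (2 * Real.pi * ‖ξ‖) ^ 2) ^ ((d : ℝ) / 4) *
    (p ^ d * Real.exp (-(Real.pi * p ^ 2) * ‖ξ‖ ^ 2))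

theorem memLp_two_ofReal_gaussian (c : ℝ) {b : ℝ} (hb : 0 < b) :
    MemLp (fun v : EuclideanSpace ℝ (Fin d) => ((c * Real.exp (-b * ‖v‖ ^ 2) : ℝ) : ℂ)) 2 := by
  rw [memLp_two_iff_integrable_sq_norm (by fun_prop)]
  refine ((integrable_exp_neg_mul_norm_sq (d := d) (b := 2 * b) (by positivity)).const_mul
    (c ^ 2)).congr (Eventually.of_forall fun v => ?_)
  simp only [Complex.norm_real, Real.norm_eq_abs, sq_abs, mul_pow, ← Real.exp_nat_mul]
  congr 2
  push_cast; ring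

theorem fourier_gauss {p : ℝ} (hp : 0 < p) :
    𝓕 (gauss p : EuclideanSpace ℝ (Fin d) → ℂ) = gaussHat p := by
  ext ξ
  have h := fourier_gaussian_innerProductSpace (V := EuclideanSpace ℝ (Fin d))
    (b := ((Real.pi / p ^ 2 : ℝ) : ℂ)) (by rw [Complex.ofReal_re]; positivity) ξ
  have e : (gauss p : EuclideanSpace ℝ (Fin d) → ℂ) =
      fun v => Complex.exp (-((Real.pi / p ^ 2 : ℝ) : ℂ) * ‖v‖ ^ 2) := by
    ext v; rw [gauss]; push_cast; rfl
  rw [e, h, gaussHat]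
  have e1 : ((Real.pi : ℂ) / ((Real.pi / p ^ 2 : ℝ) : ℂ)) = ((p ^ 2 : ℝ) : ℂ) := by
    rw [← Complex.ofReal_div]; congr 1; field_simp
  have e2 : -(Real.pi : ℂ) ^ 2 * (‖ξ‖ : ℂ) ^ 2 / ((Real.pi / p ^ 2 : ℝ) : ℂ) =
      ((-(Real.pi * p ^ 2) * ‖ξ‖ ^ 2 : ℝ) : ℂ) := by
    have : (p : ℂ) ≠ 0 := by exact_mod_cast hp.ne'
    have : (Real.pi : ℂ) ≠ 0 := by exact_mod_cast Real.pi_ne_zero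
    push_cast; field_simp
  rw [e1, e2, finrank_euclideanSpace_fin]
  have e3 : ((d : ℂ) / 2) = (((d : ℝ) / 2 : ℝ) : ℂ) := by push_cast; rfl
  rw [e3, ← Complex.ofReal_cpow (by positivity), ← Real.rpow_natCast, ← Real.rpow_mul hp.le]
  push_cast
  rw [show (2 : ℝ) * (d / 2) = d by ring, Real.rpow_natCast]
  push_cast; rfl

theorem integrable_gauss {p : ℝ} (hp : 0 < p) :
    Integrable (gauss p : EuclideanSpace ℝ (Fin d) → ℂ) :=
  (integrable_exp_neg_mul_norm_sq (by positivity)).ofReal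

theorem memLp_gauss {p : ℝ} (hp : 0 < p) :
    MemLp (gauss p : EuclideanSpace ℝ (Fin d) → ℂ) 2 := by
  have := memLp_two_ofReal_gaussian (d := d) 1 (b := Real.pi / p ^ 2) (by positivity)
  simp only [one_mul] at this
  exact this

theorem memLp_gaussHat {p : ℝ} (hp : 0 < p) :
    MemLp (gaussHat p : EuclideanSpace ℝ (Fin d) → ℂ) 2 :=
  memLp_two_ofReal_gaussian (d := d) (p ^ d) (b := Real.pi * p ^ 2) (by positivity)

theorem besselSymbol_mul_besselGaussHat (p : ℝ) (ξ : EuclideanSpace ℝ (Fin d)) :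
    SymmetricSpaces.besselSymbol ((d : ℝ≥0) / 4) ξ * (besselGaussHat p ξ : ℂ) = gaussHat p ξ := by
  rw [SymmetricSpaces.besselSymbol, besselGaussHat, gaussHat, ← Complex.ofReal_mul, ← mul_assoc,
    ← Real.rpow_add (by positivity)]
  simp

/-- Half of the Gaussian exponent absorbs the polynomial weight, via `1 + s ≤ exp s`. The price is a
factor `a^{-d/2}`, the scaling needed for the inner product estimate. -/
theorem one_add_rpow_mul_le (hd : 0 < d) {a : ℝ} (ha : 0 < a) (ha2 : a ≤ 2) (X : ℝ) :
    (1 + (2 * Real.pi * X) ^ 2) ^ ((d : ℝ) / 2) * Real.exp (-(Real.pi * a) * X ^ 2) ≤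
      (8 * Real.pi * d / a) ^ ((d : ℝ) / 2) * Real.exp (-(Real.pi * a / 2) * X ^ 2) := by
  have hd' : (0 : ℝ) < d := by exact_mod_cast hd
  have hd1 : (1 : ℝ) ≤ d := by exact_mod_cast hd
  -- `u` is half the exponent; `8πd/a` is the factor for which `8πd/a · u/d = (2πX)²`.
  set u : ℝ := Real.pi * a / 2 * X ^ 2 with hu
  have hu0 : 0 ≤ u := by positivity
  have h1 : 1 + (2 * Real.pi * X) ^ 2 ≤ 8 * Real.pi * d / a * Real.exp (u / d) := by
    have h2 : 1 + u / d ≤ Real.exp (u / d) := by linarith [Real.add_one_le_exp (u / d)]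
    have h3 : 8 * Real.pi * d / a * (1 + u / d) ≤ 8 * Real.pi * d / a * Real.exp (u / d) := by
      gcongr
    refine le_trans ?_ h3
    have h4 : 8 * Real.pi * d / a * (1 + u / d) = 8 * Real.pi * d / a + (2 * Real.pi * X) ^ 2 := by
      rw [hu]; field_simp; ring
    rw [h4]
    have : 1 ≤ 8 * Real.pi * d / a := by
      rw [le_div_iff₀ ha]
      nlinarith [Real.pi_gt_three]
    linarith
  have h5 : (1 + (2 * Real.pi * X) ^ 2) ^ ((d : ℝ) / 2) ≤
      (8 * Real.pi * d / a) ^ ((d : ℝ) / 2) * Real.exp (u / 2) := by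
    refine (Real.rpow_le_rpow (by positivity) h1 (by positivity)).trans_eq ?_
    rw [Real.mul_rpow (by positivity) (Real.exp_pos _).le, ← Real.exp_mul]
    congr 2
    field_simp
  calc _ ≤ (8 * Real.pi * d / a) ^ ((d : ℝ) / 2) * Real.exp (u / 2) *
        Real.exp (-(Real.pi * a) * X ^ 2) := by gcongr
    _ = (8 * Real.pi * d / a) ^ ((d : ℝ) / 2) * Real.exp (u / 2 + -(Real.pi * a) * X ^ 2) := by
        rw [mul_assoc, ← Real.exp_add]
    _ ≤ _ := by
        gcongr
        rw [hu] at *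
        linarith

theorem besselGaussHat_nonneg {p : ℝ} (hp : 0 < p) (ξ : EuclideanSpace ℝ (Fin d)) :
    0 ≤ besselGaussHat p ξ := by unfold besselGaussHat; positivity

theorem continuous_besselGaussHat (p : ℝ) :
    Continuous (besselGaussHat p : EuclideanSpace ℝ (Fin d) → ℝ) := by
  unfold besselGaussHat
  refine Continuous.mul (Continuous.rpow_const (by fun_prop) fun ξ => ?_) (by fun_prop)
  exact Or.inl (by positivity)

theorem besselGaussHat_mul_le (hd : 0 < d) {p q : ℝ} (hp : 0 < p) (hp1 : p ≤ 1) (hq : 0 < q)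
    (hq1 : q ≤ 1) (ξ : EuclideanSpace ℝ (Fin d)) :
    besselGaussHat p ξ * besselGaussHat q ξ ≤
      (p * q) ^ d * (8 * Real.pi * d / (p ^ 2 + q ^ 2)) ^ ((d : ℝ) / 2) *
        Real.exp (-(Real.pi * (p ^ 2 + q ^ 2) / 2) * ‖ξ‖ ^ 2) := by
  have h := one_add_rpow_mul_le hd (a := p ^ 2 + q ^ 2) (by positivity) (by nlinarith) ‖ξ‖
  have e : besselGaussHat p ξ * besselGaussHat q ξ = (p * q) ^ d *
      ((1 + (2 * Real.pi * ‖ξ‖) ^ 2) ^ ((d : ℝ) / 2) *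
        Real.exp (-(Real.pi * (p ^ 2 + q ^ 2)) * ‖ξ‖ ^ 2)) := by
    have e1 : (1 + (2 * Real.pi * ‖ξ‖) ^ 2) ^ ((d : ℝ) / 2) =
        (1 + (2 * Real.pi * ‖ξ‖) ^ 2) ^ ((d : ℝ) / 4) *
          (1 + (2 * Real.pi * ‖ξ‖) ^ 2) ^ ((d : ℝ) / 4) := by
      rw [← Real.rpow_add (by positivity)]; congr 1; ring
    have e2 : Real.exp (-(Real.pi * (p ^ 2 + q ^ 2)) * ‖ξ‖ ^ 2) =
        Real.exp (-(Real.pi * p ^ 2) * ‖ξ‖ ^ 2) * Real.exp (-(Real.pi * q ^ 2) * ‖ξ‖ ^ 2) := by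
      rw [← Real.exp_add]; congr 1; ring
    rw [e1, e2, besselGaussHat, besselGaussHat]
    ring
  rw [e, mul_assoc ((p * q) ^ d)]
  exact mul_le_mul_of_nonneg_left h (by positivity)

theorem integrable_besselGaussHat_mul (hd : 0 < d) {p q : ℝ} (hp : 0 < p) (hp1 : p ≤ 1)
    (hq : 0 < q) (hq1 : q ≤ 1) : Integrable fun ξ : EuclideanSpace ℝ (Fin d) =>
      besselGaussHat p ξ * besselGaussHat q ξ := by
  refine Integrable.mono' ((integrable_exp_neg_mul_norm_sq
    (b := Real.pi * (p ^ 2 + q ^ 2) / 2) (by positivity)).const_mul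
      ((p * q) ^ d * (8 * Real.pi * d / (p ^ 2 + q ^ 2)) ^ ((d : ℝ) / 2)))
    ((continuous_besselGaussHat p).mul (continuous_besselGaussHat q)).aestronglyMeasurable
    (Eventually.of_forall fun ξ => ?_)
  rw [Real.norm_of_nonneg (mul_nonneg (besselGaussHat_nonneg hp ξ) (besselGaussHat_nonneg hq ξ))]
  exact besselGaussHat_mul_le hd hp hp1 hq hq1 ξ

/-- The weight bound contributes `(p² + q²)^{-d/2}` and the Gaussian integral another such factor;
with the normalisation `(pq)^d` this becomes a scale-invariant quantity, small when `p` and `q` are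
far apart. -/
theorem integral_besselGaussHat_mul_le (hd : 0 < d) {p q : ℝ} (hp : 0 < p) (hp1 : p ≤ 1)
    (hq : 0 < q) (hq1 : q ≤ 1) :
    ∫ ξ : EuclideanSpace ℝ (Fin d), besselGaussHat p ξ * besselGaussHat q ξ ≤
      (16 * Real.pi * d) ^ ((d : ℝ) / 2) * (p * q / (p ^ 2 + q ^ 2)) ^ d := by
  have h := integral_mono (integrable_besselGaussHat_mul hd hp hp1 hq hq1)
    ((integrable_exp_neg_mul_norm_sq (d := d)
    (b := Real.pi * (p ^ 2 + q ^ 2) / 2) (by positivity)).const_mul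
      ((p * q) ^ d * (8 * Real.pi * d / (p ^ 2 + q ^ 2)) ^ ((d : ℝ) / 2)))
    (besselGaussHat_mul_le hd hp hp1 hq hq1)
  refine h.trans_eq ?_
  rw [integral_const_mul, GaussianFourier.integral_rexp_neg_mul_sq_norm (by positivity),
    finrank_euclideanSpace_fin, mul_assoc, ← Real.mul_rpow (by positivity) (by positivity),
    div_pow]
  have e : 8 * Real.pi * d / (p ^ 2 + q ^ 2) * (Real.pi / (Real.pi * (p ^ 2 + q ^ 2) / 2)) =
      16 * Real.pi * d * ((p ^ 2 + q ^ 2)⁻¹) ^ 2 := by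
    field_simp; ring
  have e2 : (((p ^ 2 + q ^ 2)⁻¹) ^ 2) ^ ((d : ℝ) / 2) = ((p ^ 2 + q ^ 2) ^ d)⁻¹ := by
    rw [← Real.rpow_natCast _ 2, ← Real.rpow_mul (by positivity), Nat.cast_ofNat,
      show (2 : ℝ) * (d / 2) = d by ring, Real.rpow_natCast, inv_pow]
  rw [e, Real.mul_rpow (by positivity) (by positivity), e2]
  ring

theorem memLp_besselGaussHat (hd : 0 < d) {p : ℝ} (hp : 0 < p) (hp1 : p ≤ 1) :
    MemLp (fun ξ : EuclideanSpace ℝ (Fin d) => (besselGaussHat p ξ : ℂ)) 2 := by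
  have hc : Continuous fun ξ : EuclideanSpace ℝ (Fin d) => (besselGaussHat p ξ : ℂ) :=
    Complex.continuous_ofReal.comp (continuous_besselGaussHat p)
  rw [memLp_two_iff_integrable_sq_norm hc.aestronglyMeasurable]
  refine (integrable_besselGaussHat_mul hd hp hp1 hp hp1).congr (Eventually.of_forall fun ξ => ?_)
  simp only [Complex.norm_real, Real.norm_eq_abs, sq, abs_mul_abs_self]

theorem norm_inner_besselGaussHat_le (hd : 0 < d) {p q : ℝ} (hp : 0 < p) (hp1 : p ≤ 1)
    (hq : 0 < q) (hq1 : q ≤ 1) :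
    ‖inner ℂ ((memLp_besselGaussHat hd hp hp1).toLp _ : Lp ℂ 2 volume)
      ((memLp_besselGaussHat hd hq hq1).toLp _)‖ ≤
      (16 * Real.pi * d) ^ ((d : ℝ) / 2) * (p * q / (p ^ 2 + q ^ 2)) ^ d := by
  rw [L2.inner_def]
  refine le_trans (norm_integral_le_integral_norm _) ?_
  refine le_trans (le_of_eq ?_) (integral_besselGaussHat_mul_le hd hp hp1 hq hq1)
  apply integral_congr_ae
  filter_upwards [(memLp_besselGaussHat hd hp hp1).coeFn_toLp,
    (memLp_besselGaussHat hd hq hq1).coeFn_toLp] with ξ h1 h2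
  rw [h1, h2]
  simp [abs_of_nonneg (besselGaussHat_nonneg hp ξ), abs_of_nonneg (besselGaussHat_nonneg hq ξ),
    mul_comm]

theorem half_pow_mul_div_le (j k : ℕ) :
    (1 / 2 : ℝ) ^ j * (1 / 2) ^ k / (((1 / 2) ^ j) ^ 2 + ((1 / 2) ^ k) ^ 2) ≤
      (1 / 2) ^ ((j - k) + (k - j)) := by
  rw [div_le_iff₀ (by positivity)]
  rcases le_total j k with h | h
  · obtain ⟨m, rfl⟩ := Nat.exists_eq_add_of_le h
    rw [show j - (j + m) + (j + m - j) = m by omega, pow_add]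
    nlinarith [show (0 : ℝ) ≤ (1 / 2) ^ m * ((1 / 2) ^ j * (1 / 2) ^ m) ^ 2 by positivity]
  · obtain ⟨m, rfl⟩ := Nat.exists_eq_add_of_le h
    rw [show k + m - k + (k - (k + m)) = m by omega, pow_add]
    nlinarith [show (0 : ℝ) ≤ (1 / 2) ^ m * ((1 / 2) ^ k * (1 / 2) ^ m) ^ 2 by positivity]

theorem half_pow_pos (k : ℕ) : (0 : ℝ) < (1 / 2) ^ k := by positivity

theorem half_pow_le_one (k : ℕ) : ((1 : ℝ) / 2) ^ k ≤ 1 :=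
  pow_le_one₀ (by norm_num) (by norm_num)

/-- The class in `L_2` of `besselGaussHat` at scale `2⁻ᵏ`. -/
noncomputable def besselGaussHatLp (hd : 0 < d) (k : ℕ) :
    Lp ℂ 2 (volume : Measure (EuclideanSpace ℝ (Fin d))) :=
  (memLp_besselGaussHat hd (half_pow_pos k) (half_pow_le_one k)).toLp _

theorem norm_inner_besselGaussHatLp_le (hd : 0 < d) (j k : ℕ) :
    ‖inner ℂ (besselGaussHatLp hd j) (besselGaussHatLp hd k)‖ ≤
      (16 * Real.pi * d) ^ ((d : ℝ) / 2) * (1 / 2 : ℝ) ^ ((j - k) + (k - j)) := by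
  refine (norm_inner_besselGaussHat_le hd (half_pow_pos j) (half_pow_le_one j) (half_pow_pos k)
    (half_pow_le_one k)).trans ?_
  gcongr
  refine le_trans ?_ (half_pow_mul_div_le j k)
  -- The ratio is at most `1`, so its `d`-th power may be replaced by the ratio itself.
  refine pow_le_of_le_one (by positivity) ?_ hd.ne'
  exact (half_pow_mul_div_le j k).trans (half_pow_le_one _)

theorem oneSubLaplacianNegPow_fourierInv_besselGaussHatLp (hd : 0 < d) (k : ℕ) :
    SymmetricSpaces.oneSubLaplacianNegPow ((d : ℝ≥0) / 4) (𝓕⁻ (besselGaussHatLp hd k)) =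
      (memLp_gauss (half_pow_pos k)).toLp (gauss ((1 / 2) ^ k)) := by
  rw [SymmetricSpaces.oneSubLaplacianNegPow, FourierTransform.fourier_fourierInv_eq]
  have hF2 : MemLp (𝓕 (gauss ((1 / 2) ^ k) : EuclideanSpace ℝ (Fin d) → ℂ)) 2 := by
    rw [fourier_gauss (half_pow_pos k)]; exact memLp_gaussHat (half_pow_pos k)
  have h := fourier_toLp_eq_of_integrable (integrable_gauss (d := d) (half_pow_pos k))
    (memLp_gauss (half_pow_pos k)) hF2
  rw [← FourierTransform.fourierInv_fourier_eq
    (F := Lp ℂ 2 (volume : Measure (EuclideanSpace ℝ (Fin d)))) ((memLp_gauss (half_pow_pos k)).toLp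
    (gauss ((1 / 2) ^ k)) : Lp ℂ 2 (volume : Measure (EuclideanSpace ℝ (Fin d)))), h]
  congr 1
  apply Lp.ext
  filter_upwards [Lp.coeFn_lpSMul (p := ∞) (q := 2) (r := 2)
      ((SymmetricSpaces.memLp_besselSymbol (d := d) ((d : ℝ≥0) / 4)).toLp _)
      (besselGaussHatLp hd k),
    (SymmetricSpaces.memLp_besselSymbol (d := d) ((d : ℝ≥0) / 4)).coeFn_toLp,
    (memLp_besselGaussHat hd (half_pow_pos k) (half_pow_le_one k)).coeFn_toLp, hF2.coeFn_toLp]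
    with ξ h1 h2 h3 h4
  rw [h1, h4, Pi.smul_apply', h2, besselGaussHatLp, h3, smul_eq_mul,
    besselSymbol_mul_besselGaussHat, fourier_gauss (half_pow_pos k)]

/-- The map `h ↦ (1 - Δ)^{-α} 𝓕⁻¹ h` as a bounded linear operator. -/
noncomputable def besselFourierInvL (d : ℕ) (α : ℝ≥0) :
    Lp ℂ 2 (volume : Measure (EuclideanSpace ℝ (Fin d))) →L[ℂ]
      Lp ℂ 2 (volume : Measure (EuclideanSpace ℝ (Fin d))) :=
  ((Lp.fourierTransformₗᵢ (EuclideanSpace ℝ (Fin d)) ℂ).symm.toContinuousLinearEquiv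
    |>.toContinuousLinearMap).comp
    ((ContinuousLinearMap.lsmul ℂ ℂ).holderL volume ∞ 2 2
      ((SymmetricSpaces.memLp_besselSymbol (d := d) α).toLp _))

theorem besselFourierInvL_apply (α : ℝ≥0)
    (h : Lp ℂ 2 (volume : Measure (EuclideanSpace ℝ (Fin d)))) :
    besselFourierInvL d α h = SymmetricSpaces.oneSubLaplacianNegPow α (𝓕⁻ h) := by
  rw [SymmetricSpaces.oneSubLaplacianNegPow, FourierTransform.fourier_fourierInv_eq]
  rfl

theorem exists_oneSubLaplacianNegPow_ge (hd : 0 < d) {b : ℕ → ℝ} (hb0 : ∀ k, 0 ≤ b k)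
    (hb : Summable fun k => b k ^ 2) :
    ∃ x : Lp ℂ 2 (volume : Measure (EuclideanSpace ℝ (Fin d))), ∀ᵐ t, ∀ N : ℕ,
      ∑ k ∈ Finset.range N, b k * Real.exp (-(Real.pi * 4 ^ k) * ‖t‖ ^ 2) ≤
        ‖SymmetricSpaces.oneSubLaplacianNegPow ((d : ℝ≥0) / 4) x t‖ := by
  have hs := summable_smul_of_almost_orthogonal (norm_inner_besselGaussHatLp_le hd) hb
  have hLk : ∀ k, besselFourierInvL d ((d : ℝ≥0) / 4) (besselGaussHatLp hd k) =
      (memLp_gauss (half_pow_pos k)).toLp (gauss ((1 / 2) ^ k)) := fun k => by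
    rw [besselFourierInvL_apply, oneSubLaplacianNegPow_fourierInv_besselGaussHatLp]
  refine ⟨𝓕⁻ (∑' k, (b k : ℂ) • besselGaussHatLp hd k), ?_⟩
  have hlim := (hs.hasSum.mapL (besselFourierInvL d ((d : ℝ≥0) / 4))).tendsto_sum_nat
  simp only [map_smul, hLk, besselFourierInvL_apply] at hlim
  -- Convergence in `L²` only gives pointwise convergence along a subsequence. This suffices: the
  -- terms are nonnegative, so each partial sum lies below the limit.
  obtain ⟨ns, hns, hae⟩ := (tendstoInMeasure_of_tendsto_Lp hlim).exists_seq_tendsto_ae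
  have hsum : ∀ᵐ t : EuclideanSpace ℝ (Fin d), ∀ N : ℕ,
      (∑ k ∈ Finset.range N, (b k : ℂ) • (memLp_gauss (half_pow_pos k)).toLp
        (gauss ((1 / 2) ^ k)) : Lp ℂ 2 (volume : Measure (EuclideanSpace ℝ (Fin d)))) t =
      ((∑ k ∈ Finset.range N, b k * Real.exp (-(Real.pi * 4 ^ k) * ‖t‖ ^ 2) : ℝ) : ℂ) := by
    rw [ae_all_iff]
    intro N
    have hk : ∀ᵐ t : EuclideanSpace ℝ (Fin d), ∀ k : ℕ, ((b k : ℂ) •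
        (memLp_gauss (half_pow_pos k)).toLp (gauss ((1 / 2) ^ k)) :
          Lp ℂ 2 (volume : Measure (EuclideanSpace ℝ (Fin d)))) t =
          ((b k * Real.exp (-(Real.pi * 4 ^ k) * ‖t‖ ^ 2) : ℝ) : ℂ) := by
      rw [ae_all_iff]
      intro k
      filter_upwards [Lp.coeFn_smul (b k : ℂ) ((memLp_gauss (half_pow_pos k)).toLp
        (gauss ((1 / 2) ^ k) : EuclideanSpace ℝ (Fin d) → ℂ)),
        (memLp_gauss (d := d) (half_pow_pos k)).coeFn_toLp] with t h1 h2
      rw [h1, Pi.smul_apply, h2, gauss, smul_eq_mul, ← Complex.ofReal_mul]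
      congr 4
      rw [← pow_mul, one_div, inv_pow, div_inv_eq_mul, mul_comm k 2, pow_mul]
      norm_num
    induction N with
    | zero =>
      filter_upwards [Lp.coeFn_zero ℂ 2 (volume : Measure (EuclideanSpace ℝ (Fin d)))]
      simp
    | succ N ih =>
      filter_upwards [ih, hk, Lp.coeFn_add (∑ k ∈ Finset.range N, (b k : ℂ) •
        (memLp_gauss (half_pow_pos k)).toLp (gauss ((1 / 2) ^ k)) :
          Lp ℂ 2 (volume : Measure (EuclideanSpace ℝ (Fin d)))) ((b N : ℂ) •
        (memLp_gauss (half_pow_pos N)).toLp (gauss ((1 / 2) ^ N)))] with t h1 h2 h3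
      rw [Finset.sum_range_succ, h3, Pi.add_apply, h1, h2, Finset.sum_range_succ,
        Complex.ofReal_add]
  filter_upwards [hae, hsum] with t h1 h2 N
  simp only [h2] at h1
  refine ge_of_tendsto h1.norm ?_
  filter_upwards [hns.tendsto_atTop.eventually_ge_atTop N] with i hi
  rw [Complex.norm_real, Real.norm_of_nonneg
    (Finset.sum_nonneg fun k _ => mul_nonneg (hb0 k) (Real.exp_pos _).le)]
  exact Finset.sum_le_sum_of_subset_of_nonneg (Finset.range_mono hi)
    fun k _ _ => mul_nonneg (hb0 k) (Real.exp_pos _).le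

end Gaussians

namespace SymmetricSpaces

/-! ### Distribution functions and decreasing rearrangements -/

section Rearrangement

variable {Ω : Type*} [MeasurableSpace Ω] {ν : Measure Ω}

/-- The infimum is attained: `{s < |f|}` is the increasing union of `{u_n < |f|}` for `u_n ↓ s`, and
continuity from below needs no finiteness. -/
theorem rearr_le_iff {f : Ω →ₘ[ν] ℂ} {t : ℝ} {s : ℝ≥0∞} :
    rearr ν f t ≤ s ↔ ν {x | s < ‖f x‖ₑ} ≤ ENNReal.ofReal t := by
  refine ⟨fun h => ?_, fun h => sInf_le h⟩
  rcases eq_or_ne s ∞ with rfl | hs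
  · simp
  have hlt : ∀ u, s < u → ν {x | u < ‖f x‖ₑ} ≤ ENNReal.ofReal t := fun u hu => by
    obtain ⟨w, hw, hwu⟩ := sInf_lt_iff.1 (h.trans_lt hu)
    exact (measure_mono fun x (hx : u < ‖f x‖ₑ) => hwu.trans hx).trans hw
  obtain ⟨u, hu_anti, hu_gt, hu_lim⟩ := exists_seq_strictAnti_tendsto' (lt_top_iff_ne_top.2 hs)
  have hU : {x | s < ‖f x‖ₑ} = ⋃ n, {x | u n < ‖f x‖ₑ} := by
    ext x
    simp only [mem_ofPred_eq, mem_iUnion]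
    refine ⟨fun hx => ?_, fun ⟨n, hn⟩ => (hu_gt n).1.trans hn⟩
    exact (hu_lim.eventually_lt_const hx).exists
  have hmono : Monotone fun n => {x | u n < ‖f x‖ₑ} := fun m n hmn x (hx : u m < ‖f x‖ₑ) =>
    (hu_anti.antitone hmn).trans_lt hx
  rw [hU, hmono.measure_iUnion]
  exact iSup_le fun n => hlt _ (hu_gt n).1

theorem lt_rearr_iff {f : Ω →ₘ[ν] ℂ} {t : ℝ} {s : ℝ≥0∞} :
    s < rearr ν f t ↔ ENNReal.ofReal t < ν {x | s < ‖f x‖ₑ} := by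
  rw [← not_le, rearr_le_iff, not_le]

theorem rearr_antitone (f : Ω →ₘ[ν] ℂ) : Antitone (rearr ν f) := fun _ _ hab =>
  sInf_le_sInf fun _ hu => le_trans hu (ENNReal.ofReal_le_ofReal hab)

theorem rearr_mono {f g : Ω →ₘ[ν] ℂ} (h : ∀ᵐ x ∂ν, ‖f x‖ ≤ ‖g x‖) (t : ℝ) :
    rearr ν f t ≤ rearr ν g t := by
  refine sInf_le_sInf fun u hu => le_trans (measure_mono_ae ?_) hu
  filter_upwards [h] with x hx hux
  exact lt_of_lt_of_le hux (enorm_le_iff_norm_le.2 hx)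

theorem rearr_sq_le_rearr_absSq (f : Ω →ₘ[ν] ℂ) (t : ℝ) :
    rearr ν f t ^ 2 ≤ rearr ν (absSq f) t := by
  refine le_sInf fun u hu => ?_
  have h1 : rearr ν f t ≤ u ^ (1 / 2 : ℝ) := by
    rw [rearr_le_iff]
    refine le_trans (measure_mono_ae ?_) hu
    filter_upwards [AEEqFun.coeFn_comp (fun z : ℂ => ((‖z‖ ^ 2 : ℝ) : ℂ)) (by fun_prop) f]
      with x hx
    intro (hux : u ^ (1 / 2 : ℝ) < ‖f x‖ₑ)
    change u < ‖absSq f x‖ₑ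
    have e : ‖absSq f x‖ₑ = ‖f x‖ₑ ^ (2 : ℝ) := by
      rw [absSq, hx, Function.comp_apply]
      rw [← ofReal_norm, Complex.norm_real, ofReal_norm, enorm_pow, enorm_norm, ENNReal.rpow_ofNat]
    rw [e]
    have := ENNReal.rpow_lt_rpow hux (show (0 : ℝ) < 2 by norm_num)
    rwa [← ENNReal.rpow_mul, one_div_mul_cancel two_ne_zero, ENNReal.rpow_one] at this
  calc rearr ν f t ^ 2 ≤ (u ^ (1 / 2 : ℝ)) ^ 2 := by gcongr
    _ = u := by
      rw [← ENNReal.rpow_natCast, ← ENNReal.rpow_mul]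
      norm_num

theorem measurableSet_lt_enorm (f : Ω →ₘ[ν] ℂ) (s : ℝ≥0∞) :
    MeasurableSet {x | s < ‖f x‖ₑ} :=
  measurableSet_lt measurable_const f.measurable.enorm

theorem natCast_lt_norm_iff (z : ℂ) (n : ℕ) : (n : ℝ) < ‖z‖ ↔ (n : ℝ≥0∞) < ‖z‖ₑ := by
  rw [← ofReal_norm, ← ENNReal.ofReal_natCast, ENNReal.ofReal_lt_ofReal_iff_of_nonneg (by simp)]

theorem exists_nat_measure_lt_enorm_le {f : Ω →ₘ[ν] ℂ} (hf : f ∈ S ν) {ε : ℝ≥0∞} (hε : ε ≠ 0) :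
    ∃ n : ℕ, ν {x | (n : ℝ≥0∞) < ‖f x‖ₑ} ≤ ε := by
  obtain ⟨n, hn⟩ := hf
  simp only [natCast_lt_norm_iff] at hn
  have h := tendsto_measure_iInter_atTop (μ := ν) (s := fun n : ℕ => {x | (n : ℝ≥0∞) < ‖f x‖ₑ})
    (fun n => (measurableSet_lt_enorm f n).nullMeasurableSet)
    (fun m n hmn x (hx : (n : ℝ≥0∞) < ‖f x‖ₑ) => lt_of_le_of_lt (by exact_mod_cast hmn) hx)
    ⟨n, hn.ne⟩
  have he : ⋂ n : ℕ, {x | (n : ℝ≥0∞) < ‖f x‖ₑ} = ∅ := by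
    ext x
    simp only [mem_iInter, mem_ofPred_eq, mem_empty_iff_false, iff_false, not_forall, not_lt]
    obtain ⟨m, hm⟩ := ENNReal.exists_nat_gt (enorm_ne_top (x := f x))
    exact ⟨m, hm.le⟩
  rw [he, measure_empty] at h
  obtain ⟨m, hm⟩ := (h.eventually_lt_const (pos_iff_ne_zero.2 hε)).exists
  exact ⟨m, hm.le⟩

theorem rearr_ne_top {f : Ω →ₘ[ν] ℂ} (hf : f ∈ S ν) {t : ℝ} (ht : 0 < t) : rearr ν f t ≠ ∞ := by
  obtain ⟨n, hn⟩ := exists_nat_measure_lt_enorm_le hf (ENNReal.ofReal_pos.2 ht).ne'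
  exact ne_top_of_le_ne_top (ENNReal.natCast_ne_top n) (rearr_le_iff.2 hn)

theorem mem_S_of_measure_ne_top {f : Ω →ₘ[ν] ℂ} (hf : ν {x | 0 < ‖f x‖ₑ} ≠ ∞) : f ∈ S ν := by
  refine ⟨0, lt_of_le_of_lt (measure_mono fun x hx => ?_) (lt_top_iff_ne_top.2 hf)⟩
  have := (natCast_lt_norm_iff (f x) 0).1 hx
  simpa using this

theorem rearr_eq_of_forall_measure_eq {Ω' : Type*} [MeasurableSpace Ω'] {ν' : Measure Ω'}
    {f : Ω →ₘ[ν] ℂ} {g : Ω' →ₘ[ν'] ℂ}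
    (h : ∀ s : ℝ≥0∞, ν {x | s < ‖f x‖ₑ} = ν' {x | s < ‖g x‖ₑ}) (t : ℝ) :
    rearr ν f t = rearr ν' g t := by
  simp only [rearr, h]

end Rearrangement

/-! ### Radial rearrangement on `ℝ^d` -/

section Radial

variable {d : ℕ}

/-- The volume of the Euclidean unit ball. -/
noncomputable def unitBallVolume (d : ℕ) : ℝ :=
  (volume : Measure (EuclideanSpace ℝ (Fin d))).real (Metric.ball 0 1)

theorem unitBallVolume_pos (d : ℕ) : 0 < unitBallVolume d :=
  ENNReal.toReal_pos (Metric.measure_ball_pos _ _ one_pos).ne' measure_ball_lt_top.ne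

theorem ofReal_unitBallVolume (d : ℕ) : ENNReal.ofReal (unitBallVolume d) =
    (volume : Measure (EuclideanSpace ℝ (Fin d))) (Metric.ball 0 1) :=
  ENNReal.ofReal_toReal measure_ball_lt_top.ne

theorem volume_setOf_unitBallVolume_mul_lt (hd : 0 < d) {D : ℝ≥0∞} (hD : D ≠ ∞) :
    volume {x : EuclideanSpace ℝ (Fin d) | ENNReal.ofReal (unitBallVolume d * ‖x‖ ^ d) < D} =
      D := by
  lift D to ℝ≥0 using hD
  have : Nonempty (Fin d) := ⟨⟨0, hd⟩⟩
  have hv := unitBallVolume_pos d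
  set r : ℝ := ((D : ℝ) / unitBallVolume d) ^ ((d : ℝ)⁻¹) with hr
  have hr0 : 0 ≤ r := by positivity
  have hrd : r ^ d = (D : ℝ) / unitBallVolume d :=
    Real.rpow_inv_natCast_pow (by positivity) hd.ne'
  have hset : {x : EuclideanSpace ℝ (Fin d) | ENNReal.ofReal (unitBallVolume d * ‖x‖ ^ d) < D} =
      Metric.ball 0 r := by
    ext x
    rw [mem_ofPred_eq, mem_ball_zero_iff, ← ENNReal.ofReal_coe_nnreal,
      ENNReal.ofReal_lt_ofReal_iff_of_nonneg (by positivity),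
      ← pow_lt_pow_iff_left₀ (norm_nonneg x) hr0 hd.ne', hrd, lt_div_iff₀ hv, mul_comm]
  rw [hset, Measure.addHaar_ball _ _ hr0, ← ofReal_unitBallVolume, finrank_euclideanSpace_fin, hrd,
    ← ENNReal.ofReal_mul (by positivity), div_mul_cancel₀ _ hv.ne', ENNReal.ofReal_coe_nnreal]

/-- The radial function `x ↦ f*(|B(0, |x|)|)`. -/
noncomputable def radialFun (f : EuclideanSpace ℝ (Fin d) →ₘ[volume] ℂ)
    (x : EuclideanSpace ℝ (Fin d)) : ℂ :=
  ((rearr volume f (unitBallVolume d * ‖x‖ ^ d)).toReal : ℂ)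

theorem measurable_radialFun (f : EuclideanSpace ℝ (Fin d) →ₘ[volume] ℂ) :
    Measurable (radialFun f) := by
  have : Measurable (rearr volume f) := (rearr_antitone f).measurable
  unfold radialFun
  fun_prop

/-- The class of `radialFun f`. -/
noncomputable def radialRearr (f : EuclideanSpace ℝ (Fin d) →ₘ[volume] ℂ) :
    EuclideanSpace ℝ (Fin d) →ₘ[volume] ℂ :=
  AEEqFun.mk (radialFun f) (measurable_radialFun f).aestronglyMeasurable

theorem ae_enorm_radialRearr (hd : 0 < d) {f : EuclideanSpace ℝ (Fin d) →ₘ[volume] ℂ}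
    (hf : f ∈ S volume) :
    ∀ᵐ x, ‖radialRearr f x‖ₑ = rearr volume f (unitBallVolume d * ‖x‖ ^ d) := by
  have : Nonempty (Fin d) := ⟨⟨0, hd⟩⟩
  filter_upwards [AEEqFun.coeFn_mk (radialFun f) (measurable_radialFun f).aestronglyMeasurable,
    Measure.ae_ne (volume : Measure (EuclideanSpace ℝ (Fin d))) 0] with x hx hx0
  have hv := unitBallVolume_pos d
  have hn : 0 < ‖x‖ := norm_pos_iff.2 hx0
  rw [radialRearr, hx, radialFun, ← ofReal_norm, Complex.norm_real, Real.norm_of_nonneg (by simp),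
    ENNReal.ofReal_toReal (rearr_ne_top hf (by positivity))]

/-- By `lt_rearr_iff`, the superlevel set is, up to a null set, the ball whose volume is the
distribution function of `f` at `s`. The origin is excluded because `toReal` would send a possible
value `∞` there to `0`. -/
theorem measure_lt_enorm_radialRearr (hd : 0 < d) {f : EuclideanSpace ℝ (Fin d) →ₘ[volume] ℂ}
    (hf : volume {x | 0 < ‖f x‖ₑ} ≠ ∞) (s : ℝ≥0∞) :
    volume {x | s < ‖radialRearr f x‖ₑ} = volume {x | s < ‖f x‖ₑ} := by
  have hD : volume {x | s < ‖f x‖ₑ} ≠ ∞ :=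
    ne_top_of_le_ne_top hf (measure_mono fun x (hx : s < ‖f x‖ₑ) => zero_le.trans_lt hx)
  rw [← volume_setOf_unitBallVolume_mul_lt hd hD]
  apply measure_congr
  filter_upwards [ae_enorm_radialRearr hd (mem_S_of_measure_ne_top hf)] with x hx
  apply propext
  change s < _ ↔ _ < _
  rw [hx, lt_rearr_iff]

end Radial

end SymmetricSpaces

namespace SymmetricSpaces

/-! ### From the Lorentz integral to a square-summable sequence -/

section LorentzSum

theorem psiFun_half_pow {m : ℕ} (hm : 0 < m) :
    psiFun ((1 / 2) ^ m) = 1 / (1 + m * Real.log 2) := by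
  rw [psiFun_of_mem (by positivity) (pow_lt_one₀ (by norm_num) (by norm_num) hm.ne'),
    Real.log_pow, one_div 2, Real.log_inv]
  ring_nf

/-- With `L = log 2` the difference equals `aL / (XY)`, where both denominators `X`, `Y` grow at
most linearly in `k`. Here `a ≥ 2` gives `aL ≥ 1`, and `b > 0` keeps the points inside `(0, 1)`. -/
theorem le_psiFun_half_pow_sub {a b : ℕ} (ha : 2 ≤ a) (hb : 0 < b) (k : ℕ) :
    1 / ((1 + 2 * a + b) * ((k : ℝ) + 1)) ^ 2 ≤
      psiFun ((1 / 2) ^ (a * k + b)) - psiFun ((1 / 2) ^ (a * (k + 1) + b)) := by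
  rw [psiFun_half_pow (by positivity), psiFun_half_pow (by positivity)]
  have hl0 : 1 / 2 < Real.log 2 := by linarith [Real.log_two_gt_d9]
  have hl1 : Real.log 2 < 1 := by linarith [Real.log_two_lt_d9]
  set L := Real.log 2
  have ha' : (2 : ℝ) ≤ a := by exact_mod_cast ha
  have hb' : (0 : ℝ) < b := by exact_mod_cast hb
  have hk : (0 : ℝ) ≤ k := by positivity
  push_cast
  set M := (1 + 2 * a + b) * ((k : ℝ) + 1) with hM
  have hL : 0 < L := by linarith
  have hX : 0 < 1 + (a * k + b) * L := by positivity
  have hY : 0 < 1 + (a * (k + 1) + b) * L := by positivity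
  have hXM : 1 + (a * k + b) * L ≤ M := by
    have : (a * k + b) * L ≤ (a * k + b) * 1 := by gcongr
    nlinarith [mul_nonneg hb'.le hk]
  have hYM : 1 + (a * (k + 1) + b) * L ≤ M := by
    have : (a * (k + 1) + b) * L ≤ (a * (k + 1) + b) * 1 := by gcongr
    nlinarith [mul_nonneg hb'.le hk]
  rw [div_sub_div _ _ hX.ne' hY.ne', div_le_div_iff₀ (by positivity) (by positivity)]
  have h1 : (1 + (a * k + b) * L) * (1 + (a * (k + 1) + b) * L) ≤ M ^ 2 := by
    rw [sq]; gcongr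
  have h2 : 1 ≤ 1 * (1 + (a * (k + 1) + b) * L) - (1 + (a * k + b) * L) * 1 := by nlinarith
  nlinarith [sq_nonneg M]

theorem antitone_half_pow (a b : ℕ) : Antitone fun k : ℕ => (1 / 2 : ℝ) ^ (a * k + b) :=
  fun _ _ h => pow_le_pow_of_le_one (by norm_num) (by norm_num) (by gcongr)

/-- On `(r_{k+1}, r_k]` the rearrangement of `|f|²` is at least its value at `r_k`, hence at least
`f*(r_k)²`. These intervals are disjoint, so the sum of these bounds times the `dψ`-masses is
controlled by the Lorentz integral. -/
theorem summable_rearr_sq {Ω : Type*} [MeasurableSpace Ω] {ν : Measure Ω} {f : Ω →ₘ[ν] ℂ}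
    (hf : f ∈ twoConvexification (lorentzSpace psi ν)) {a b : ℕ} (ha : 2 ≤ a) (hb : 0 < b) :
    Summable fun k : ℕ => ((rearr ν f ((1 / 2) ^ (a * k + b))).toReal / (k + 1)) ^ 2 := by
  have hint := hf.2.2
  set r : ℕ → ℝ := fun k => (1 / 2 : ℝ) ^ (a * k + b) with hr
  set c : ℕ → ℝ := fun k => 1 / ((1 + 2 * a + b) * ((k : ℝ) + 1)) ^ 2 with hc
  have hsum : ∑' k, rearr ν f (r k) ^ 2 * ENNReal.ofReal (c k) ≠ ∞ := by
    refine ne_top_of_le_ne_top hint.ne ?_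
    have hdisj : Pairwise (Function.onFun Disjoint fun k => Ioc (r (k + 1)) (r k)) :=
      (antitone_half_pow a b).pairwise_disjoint_on_Ioc_succ
    calc ∑' k, rearr ν f (r k) ^ 2 * ENNReal.ofReal (c k)
        ≤ ∑' k, ∫⁻ s in Ioc (r (k + 1)) (r k), rearr ν (absSq f) s ∂psi.measure := by
          refine ENNReal.tsum_le_tsum fun k => ?_
          calc rearr ν f (r k) ^ 2 * ENNReal.ofReal (c k)
              ≤ rearr ν (absSq f) (r k) * psi.measure (Ioc (r (k + 1)) (r k)) := by
                rw [StieltjesFunction.measure_Ioc]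
                gcongr
                · exact rearr_sq_le_rearr_absSq f _
                · exact le_psiFun_half_pow_sub ha hb k
            _ = ∫⁻ _ in Ioc (r (k + 1)) (r k), rearr ν (absSq f) (r k) ∂psi.measure := by
                rw [setLIntegral_const]
            _ ≤ _ := setLIntegral_mono' measurableSet_Ioc fun s hs => rearr_antitone _ hs.2
      _ = ∫⁻ s in ⋃ k, Ioc (r (k + 1)) (r k), rearr ν (absSq f) s ∂psi.measure :=
          (lintegral_iUnion (fun _ => measurableSet_Ioc) hdisj _).symm
      _ ≤ _ := lintegral_mono_set (iUnion_subset fun k s hs =>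
          lt_trans (show (0 : ℝ) < r (k + 1) by positivity) hs.1)
  have hs := (ENNReal.summable_toReal hsum).mul_left (((1 : ℝ) + 2 * a + b) ^ 2)
  refine hs.congr fun k => ?_
  have hc0 : 0 ≤ c k := by positivity
  have hM : ((1 : ℝ) + 2 * a + b) ≠ 0 := by positivity
  rw [ENNReal.toReal_mul, ENNReal.toReal_pow, ENNReal.toReal_ofReal hc0, hc]
  field_simp
  rfl

end LorentzSum

/-! ### Domination of the radial rearrangement and conclusion -/

section Main

variable {d : ℕ}

theorem le_sum_gaussian {R : ℕ → ℝ} {M X : ℝ} {n : ℕ} (hR0 : ∀ k, 0 ≤ R k) (hM : 0 ≤ M)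
    (hR : ∀ k, n ≤ 2 * k → M ≤ R k) (hX0 : 0 ≤ X) (hX : X ≤ (1 / 2) ^ n) :
    M ≤ 2 * Real.exp Real.pi * ∑ k ∈ Finset.range (n + 1),
      R k / (k + 1) * Real.exp (-(Real.pi * 4 ^ k) * X ^ 2) := by
  -- For `n/2 ≤ k ≤ n` the Gaussian is at least `exp (-π)`, and `R k` is already at least `M`. There
  -- are at least `(n + 1)/2` such `k`, which cancels the denominator `n + 1`.
  have h1 : ∀ k ∈ Finset.Ico ((n + 1) / 2) (n + 1), M / (n + 1) * Real.exp (-Real.pi) ≤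
      R k / (k + 1) * Real.exp (-(Real.pi * 4 ^ k) * X ^ 2) := by
    intro k hk
    rw [Finset.mem_Ico] at hk
    have hk' : (k : ℝ) + 1 ≤ n + 1 := by exact_mod_cast hk.2
    have h2 : (4 : ℝ) ^ k * X ^ 2 ≤ 1 := by
      calc (4 : ℝ) ^ k * X ^ 2 ≤ 4 ^ n * ((1 / 2) ^ n) ^ 2 := by
            gcongr
            · norm_num
            · omega
        _ = 1 := by rw [← pow_mul, mul_comm n 2, pow_mul, ← mul_pow]; norm_num
    have h3 : -Real.pi ≤ -(Real.pi * 4 ^ k) * X ^ 2 := by nlinarith [Real.pi_pos]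
    have h4 := hR k (by omega)
    have h5 := hR0 k
    gcongr
  have h2 : (n + 1 : ℝ) / 2 ≤ ((n + 1 - (n + 1) / 2 : ℕ) : ℝ) := by
    rw [div_le_iff₀ two_pos]
    have : n + 1 ≤ (n + 1 - (n + 1) / 2) * 2 := by omega
    exact_mod_cast this
  have h3 : M / 2 * Real.exp (-Real.pi) ≤ ∑ k ∈ Finset.range (n + 1),
      R k / (k + 1) * Real.exp (-(Real.pi * 4 ^ k) * X ^ 2) := by
    calc M / 2 * Real.exp (-Real.pi)
        = ((n + 1 : ℝ) / 2) * (M / (n + 1) * Real.exp (-Real.pi)) := by field_simp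
      _ ≤ ((n + 1 - (n + 1) / 2 : ℕ) : ℝ) * (M / (n + 1) * Real.exp (-Real.pi)) := by gcongr
      _ = ∑ k ∈ Finset.Ico ((n + 1) / 2) (n + 1), M / (n + 1) * Real.exp (-Real.pi) := by
          rw [Finset.sum_const, Nat.card_Ico, nsmul_eq_mul]
      _ ≤ ∑ k ∈ Finset.Ico ((n + 1) / 2) (n + 1),
            R k / (k + 1) * Real.exp (-(Real.pi * 4 ^ k) * X ^ 2) := Finset.sum_le_sum h1
      _ ≤ _ := by
          refine Finset.sum_le_sum_of_subset_of_nonneg (fun k hk => ?_) fun k _ _ => ?_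
          · rw [Finset.mem_Ico] at hk
            exact Finset.mem_range.2 hk.2
          · exact mul_nonneg (div_nonneg (hR0 k) (by positivity)) (Real.exp_pos _).le
  calc M = 2 * Real.exp Real.pi * (M / 2 * Real.exp (-Real.pi)) := by
        rw [Real.exp_neg]; field_simp
    _ ≤ _ := by gcongr

/-- If `f` lies in the `2`-convexification of `Λ_ψ` and `F ≤ f` has support of measure at most that
of the unit ball, then the radial rearrangement of `F` is dominated by an element of the range of
`(1 - Δ)^{-d/4}`. -/
theorem exists_radialRearr_le (hd : 0 < d) {f F : EuclideanSpace ℝ (Fin d) →ₘ[volume] ℂ}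
    (hf : f ∈ twoConvexification (lorentzSpace psi volume)) (hFf : ∀ᵐ x, ‖F x‖ ≤ ‖f x‖)
    (hF : volume {x | 0 < ‖F x‖ₑ} ≤ ENNReal.ofReal (unitBallVolume d)) :
    ∃ x : Lp ℂ 2 (volume : Measure (EuclideanSpace ℝ (Fin d))), ∀ᵐ t,
      ‖radialRearr F t‖ ≤
        2 * Real.exp Real.pi * ‖oneSubLaplacianNegPow ((d : ℝ≥0) / 4) x t‖ := by
  have hv := unitBallVolume_pos d
  obtain ⟨q, hq⟩ : ∃ q : ℕ, (1 / 2 : ℝ) ^ q < unitBallVolume d :=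
    exists_pow_lt_of_lt_one hv (by norm_num)
  -- The factor `2d` ensures that every `k ≥ n/2` gives `r_k ≤ 2^{-(dn + d + q)}`. The extra `d`
  -- covers the loss from `2^{-n}` to `2^{-(n+1)} < |t|`, and `q` the volume of the unit ball, so
  -- `r_k ≤ v|t|^d`.
  have hb := summable_rearr_sq hf (a := 2 * d) (b := d + q) (by omega) (by omega)
  obtain ⟨x, hx⟩ := exists_oneSubLaplacianNegPow_ge hd (fun k => by positivity) hb
  refine ⟨x, ?_⟩
  have hFS : F ∈ S volume := mem_S_of_measure_ne_top (ne_top_of_le_ne_top ENNReal.ofReal_ne_top hF)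
  have : Nonempty (Fin d) := ⟨⟨0, hd⟩⟩
  filter_upwards [hx, ae_enorm_radialRearr hd hFS,
    Measure.ae_ne (volume : Measure (EuclideanSpace ℝ (Fin d))) 0] with t h1 h2 ht0
  have hn : 0 < ‖t‖ := norm_pos_iff.2 ht0
  have h3 : ‖radialRearr F t‖ = (rearr volume F (unitBallVolume d * ‖t‖ ^ d)).toReal := by
    rw [← h2, toReal_enorm]
  rcases le_or_gt ‖t‖ 1 with ht1 | ht1
  · obtain ⟨n, hn1, hn2⟩ := exists_nat_pow_near_of_lt_one hn ht1 (y := (1 / 2 : ℝ))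
      (by norm_num) (by norm_num)
    refine le_trans ?_ (mul_le_mul_of_nonneg_left (h1 (n + 1)) (by positivity))
    refine le_sum_gaussian (fun k => by positivity) (norm_nonneg _) (fun k hk => ?_) hn.le hn2
    rw [h3]
    refine ENNReal.toReal_mono (rearr_ne_top hf.1 (by positivity)) ?_
    refine (rearr_mono hFf _).trans (rearr_antitone f ?_)
    calc (1 / 2 : ℝ) ^ (2 * d * k + (d + q)) ≤ (1 / 2 : ℝ) ^ (q + (n + 1) * d) := by
          refine pow_le_pow_of_le_one (by norm_num) (by norm_num) ?_
          nlinarith [Nat.mul_le_mul_left d hk]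
      _ = (1 / 2 : ℝ) ^ q * ((1 / 2) ^ (n + 1)) ^ d := by rw [pow_add, pow_mul]
      _ ≤ _ := by gcongr
  -- Outside the unit ball the rearrangement vanishes, since the support of `F` has measure at most
  -- `v`.
  · have h4 : rearr volume F (unitBallVolume d * ‖t‖ ^ d) ≤ 0 := by
      rw [rearr_le_iff]
      refine hF.trans (ENNReal.ofReal_le_ofReal ?_)
      exact le_mul_of_one_le_right hv.le (one_le_pow₀ ht1.le)
    rw [h3, nonpos_iff_eq_zero.1 h4, ENNReal.toReal_zero]
    positivity

end Main

end SymmetricSpaces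

open SymmetricSpaces in
theorem mem_of_measure_support_le {d : ℕ} (hd : 0 < d)
    (E : SymmetricBanachFunctionSpace (volume : Measure (EuclideanSpace ℝ (Fin d))))
    (hE : ∀ x : Lp ℂ 2 (volume : Measure (EuclideanSpace ℝ (Fin d))),
      (oneSubLaplacianNegPow ((d : ℝ≥0) / 4) x :
        EuclideanSpace ℝ (Fin d) →ₘ[volume] ℂ) ∈ E.toSubmodule)
    {f F : EuclideanSpace ℝ (Fin d) →ₘ[volume] ℂ}
    (hf : f ∈ twoConvexification (lorentzSpace psi volume)) (hFf : ∀ᵐ x, ‖F x‖ ≤ ‖f x‖)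
    (hF : volume {x | 0 < ‖F x‖ₑ} ≤ ENNReal.ofReal (unitBallVolume d)) : F ∈ E.toSubmodule := by
  have hF' := ne_top_of_le_ne_top ENNReal.ofReal_ne_top hF
  obtain ⟨x, hx⟩ := exists_radialRearr_le hd hf hFf hF
  have hG : radialRearr F ∈ S volume := mem_S_of_measure_ne_top (by
    rwa [measure_lt_enorm_radialRearr hd hF'])
  set y : E.toSubmodule := ((2 * Real.exp Real.pi : ℝ) : ℂ) • ⟨_, hE x⟩ with hy
  obtain ⟨hGE, -⟩ := E.solid y _ hG (by
    filter_upwards [hx, AEEqFun.coeFn_smul ((2 * Real.exp Real.pi : ℝ) : ℂ)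
      (oneSubLaplacianNegPow ((d : ℝ≥0) / 4) x : EuclideanSpace ℝ (Fin d) →ₘ[volume] ℂ)]
      with t h1 h2
    rw [hy, Submodule.coe_smul, h2, Pi.smul_apply, norm_smul, Complex.norm_real,
      Real.norm_of_nonneg (by positivity)]
    exact h1)
  exact (E.symmetric ⟨_, hGE⟩ F (mem_S_of_measure_ne_top hF') fun t _ =>
    rearr_eq_of_forall_measure_eq (fun s => (measure_lt_enorm_radialRearr hd hF' s).symm) t).1

theorem corollary5p8 (d : ℕ) (hd : 0 < d)
    (E : SymmetricSpaces.SymmetricBanachFunctionSpace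
      (volume : Measure (EuclideanSpace ℝ (Fin d))))
    (hE : ∀ x : Lp ℂ 2 (volume : Measure (EuclideanSpace ℝ (Fin d))),
      (SymmetricSpaces.oneSubLaplacianNegPow ((d : ℝ≥0) / 4) x :
        EuclideanSpace ℝ (Fin d) →ₘ[volume] ℂ) ∈ E.toSubmodule) :
    SymmetricSpaces.twoConvexification
        (SymmetricSpaces.lorentzSpace SymmetricSpaces.psi
          (volume : Measure (EuclideanSpace ℝ (Fin d)))) ⊆
      (E.toSubmodule : Set (EuclideanSpace ℝ (Fin d) →ₘ[volume] ℂ)) +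
        (Lp ℂ ∞ (volume : Measure (EuclideanSpace ℝ (Fin d))) :
          Set (EuclideanSpace ℝ (Fin d) →ₘ[volume] ℂ)) := by
  intro f hf
  -- The cut-off height: superlevel sets of a function in `S` have measure tending to `0`, so some
  -- `{|f| > N}` has at most the volume of the unit ball.
  obtain ⟨N, hN⟩ := SymmetricSpaces.exists_nat_measure_lt_enorm_le hf.1
    (ENNReal.ofReal_pos.2 (SymmetricSpaces.unitBallVolume_pos d)).ne'
  set A : Set (EuclideanSpace ℝ (Fin d)) := {x | (N : ℝ≥0∞) < ‖f x‖ₑ} with hA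
  have hmeas : AEStronglyMeasurable (A.indicator f) (volume : Measure (EuclideanSpace ℝ (Fin d))) :=
    f.aestronglyMeasurable.indicator (SymmetricSpaces.measurableSet_lt_enorm f N)
  have hF := AEEqFun.coeFn_mk _ hmeas
  set F := AEEqFun.mk _ hmeas
  refine Set.mem_add.2 ⟨F, ?_, f - F, ?_, by abel⟩
  · refine mem_of_measure_support_le hd E hE hf ?_ (le_trans (measure_mono_ae ?_) hN)
    · filter_upwards [hF] with x hx
      rw [hx]
      exact norm_indicator_le_norm_self _ _
    · filter_upwards [hF] with x hx
      intro (h : 0 < ‖F x‖ₑ)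
      change x ∈ A
      by_contra hxA
      rw [hx, Set.indicator_of_notMem hxA] at h
      simp at h
  · refine Lp.mem_Lp_iff_memLp.2 (memLp_top_of_bound (AEEqFun.aestronglyMeasurable _) N ?_)
    filter_upwards [hF, AEEqFun.coeFn_sub f F] with x hx hs
    rw [hs, Pi.sub_apply, hx]
    by_cases hxA : x ∈ A
    · simp [Set.indicator_of_mem hxA]
    · rw [Set.indicator_of_notMem hxA, sub_zero]
      refine not_lt.1 fun h => hxA ?_
      exact (SymmetricSpaces.natCast_lt_norm_iff _ _).1 h
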